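/- A labelled graph $(G,x)$ is a finite simple connected graph $G$ with a label $x(v)\in\{0,1\}^*$ at every node; a distributed language is a set of labelled graphs. A local algorithm with running time $r$ ($r$ a constant) is a computable function that maps the radius-$r$ neighbourhood of a node, together with all data (identifiers, input labels, oracle labels, if any) of its nodes, to an output yes or no. It decides a language $L$ if for every labelled graph $(G,x)$, and for every admissible assignment of identifiers (and of oracle labels), $(G,x)\in L$ if and only if all nodes output yes. $\mathsf{LD}$ is the class of languages decided by a local algorithm in networks in which the nodes have pairwise distinct identifiers from $\mathbb N$ (and no oracle labels). A scalar oracle $f$ provides for each $N$ a list $f(N)=(f^{(N)}_1\le\dots\le f^{(N)}_N)$ of $N$ labels; it is large if $\forall c>0\ \exists k\ge 1\ \forall n\ge k:\ f^{(n)}_k\ge c$. The oracle is only given an upper bound on the size of the network: in an $n$-node network an adversary chooses any $N\ge n$ and assigns $n$ of the $N$ labels of $f(N)$ one-to-one to the nodes. $\mathsf{LDO}^f$ is the class of languages decided, in networks labelled in this way (and with pairwise distinct identifiers), by an identifier-oblivious local algorithm, that is, one whose outputs do not depend on the identifiers. The upper bound oracle is $f(N)=(N,N,\dots,N)$; thus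 it labels all nodes with some upper bound $N\ge n$ on the number $n$ of nodes. **Theorem.** The upper bound oracle $f$ is large, and there exists a distributed language $L$ such that $L\in\mathsf{LDO}^f\setminus\mathsf{LD}$. -/

import Mathlib

namespace LocalDecision

/-- A labelled graph `(G, x)`: a finite simple connected graph (its nodes are numbered
`0, …, n - 1`, and `n ≥ 1` because connected graphs are nonempty) whose nodes carry
bit strings as inputs. -/
structure LabelledGraph where
  /-- the number of nodes -/
  n : ℕ
  /-- the network -/
  graph : SimpleGraph (Fin n)
  connected : graph.Connected
  /-- the input labels -/
  input : Fin n → List Bool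

/-- A distributed language is a set of labelled graphs. -/
abbrev Language := Set LabelledGraph

/-- Finite data describing a rooted graph with node data in `α`: the list of its nodes, the root
first, each with its data and with its row of the adjacency matrix. -/
abbrev View (α : Type) := List (α × List Bool)

open Classical in
/-- `w` is a description of the radius-`r` neighbourhood of `v` in the connected graph `G` with
node data `lab`: the subgraph induced by the nodes at distance at most `r` from `v`, rooted at `v`,
with the nodes listed in some order `e` that starts with `v`. -/
def IsView {α : Type} {n : ℕ} (G : SimpleGraph (Fin n)) (lab : Fin n → α) (r : ℕ) (v : Fin n)
    (w : View α) : Prop :=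
  ∃ (m : ℕ) (e : Fin (m + 1) ≃ {u : Fin n // G.dist v u ≤ r}),
    (e 0 : Fin n) = v ∧
    w = List.ofFn fun i => (lab (e i), List.ofFn fun j => decide (G.Adj (e i) (e j)))

/-- A computable constant-time algorithm with outputs yes (`true`) and no (`false`): a running
time `radius` that does not depend on the network, and a computable function of the
radius-`radius` neighbourhood. -/
structure LocalAlgorithm (α : Type) [Primcodable α] where
  radius : ℕ
  out : View α → Bool
  computable : Computable out

/-- The output of `A` at node `v` is `b`, in whatever order the nodes of the neighbourhood of `v`
are listed. -/
def LocalAlgorithm.Outputs {α : Type} [Primcodable α] (A : LocalAlgorithm α) {n : ℕ}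
    (G : SimpleGraph (Fin n)) (lab : Fin n → α) (v : Fin n) (b : Bool) : Prop :=
  ∀ w : View α, IsView G lab A.radius v w → A.out w = b

/-- `A` decides `L` on the networks whose node data are among those allowed by `legal`: every node
outputs yes or no (its output is a function of its neighbourhood alone), and an instance belongs
to `L` if and only if all nodes output yes. -/
def LocalAlgorithm.Decides {α : Type} [Primcodable α] (A : LocalAlgorithm α) (L : Language)
    (legal : (I : LabelledGraph) → Set (Fin I.n → α)) : Prop :=
  ∀ (I : LabelledGraph), ∀ lab ∈ legal I,
    (∀ v, ∃ b, A.Outputs I.graph lab v b) ∧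
    (I ∈ L ↔ ∀ v, A.Outputs I.graph lab v true)

/-- Every node knows its identifier and its input; identifiers are pairwise distinct. -/
def idData (I : LabelledGraph) : Set (Fin I.n → ℕ × List Bool) :=
  {lab | ∃ id : Fin I.n → ℕ, Function.Injective id ∧ lab = fun v => (id v, I.input v)}

/-- The class `LD`. -/
def LD : Set Language :=
  {L | ∃ A : LocalAlgorithm (ℕ × List Bool), A.Decides L idData}

/-- A scalar oracle: for every `n` a list of `n` labels in nondecreasing order. Bit strings used
as oracle labels are identified with natural numbers. -/
structure ScalarOracle where
  label : (n : ℕ) → Fin n → ℕ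
  mono : ∀ n, Monotone (label n)

/-- `f` is large: for all `c` there is `k ≥ 1` such that for all `n ≥ k` the `k`th label provided
by `f` on input `n` is at least `c`. -/
def ScalarOracle.IsLarge (f : ScalarOracle) : Prop :=
  ∀ c > 0, ∃ k ≥ 1, ∀ (n : ℕ) (i : Fin n), (i : ℕ) + 1 = k → k ≤ n → c ≤ f.label n i

/-- The labellings of an `n`-node network by the oracle `f` when `f` only knows an upper bound
`N ≥ n` on the size of the network: the adversary chooses `N`, and assigns `n` of the `N` labels
`f(N)` one-to-one to the nodes. -/
def ScalarOracle.labellings (f : ScalarOracle) (n : ℕ) : Set (Fin n → ℕ) :=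
  {o | ∃ N ≥ n, ∃ τ : Fin n → Fin N, Function.Injective τ ∧ o = fun v => f.label N (τ v)}

/-- Every node knows its identifier, its input, and its oracle label. -/
def oracleData (f : ScalarOracle) (I : LabelledGraph) : Set (Fin I.n → ℕ × List Bool × ℕ) :=
  {lab | ∃ id : Fin I.n → ℕ, Function.Injective id ∧ ∃ o ∈ f.labellings I.n,
    lab = fun v => (id v, I.input v, o v)}

/-- `A` is identifier-oblivious: its outputs are the same for all identifier assignments. -/
def LocalAlgorithm.IdOblivious (A : LocalAlgorithm (ℕ × List Bool × ℕ)) : Prop :=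
  ∀ (I : LabelledGraph) (o : Fin I.n → ℕ) (id id' : Fin I.n → ℕ),
    Function.Injective id → Function.Injective id' → ∀ (v : Fin I.n) (b : Bool),
      A.Outputs I.graph (fun v => (id v, I.input v, o v)) v b ↔
      A.Outputs I.graph (fun v => (id' v, I.input v, o v)) v b

/-- The class `LDO^f`, for an oracle `f` that only knows an upper bound on the size of the
network. -/
def LDOWith (f : ScalarOracle) : Set Language :=
  {L | ∃ A : LocalAlgorithm (ℕ × List Bool × ℕ), A.IdOblivious ∧ A.Decides L (oracleData f)}

/-- The upper bound oracle: `f(N) = (N, N, …, N)`. -/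
def upperBoundOracle : ScalarOracle where
  label N _ := N
  mono _ _ _ _ := le_rfl

end LocalDecision

namespace LocalDecision

open Nat.Partrec (Code)
open Nat.Partrec.Code

/-! In `claimLanguage` a node claims an output of a program, and clocks must count up until the
program halts. The network is thus at least as large as the running time, so simulating `N ≥ n`
steps checks the claim (`evaln_eq_some_of_progress`). Without `N`, a node at clock `0` cannot tell
how long to simulate. Against an algorithm `A` of radius `r`, the recursion theorem gives a program
`p` that runs `A` at the first `r + 1` nodes of a long path claiming that `p` outputs `1`, and then
outputs `0` if all accept, `1` otherwise. In the second case `A` rejects a true claim. In the first,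
`A` accepts a false one: nodes farther out do not see the claim, and accept as they do on the path
with the true claim `0` (`claimLanguage_notMem_LD`). -/

theorem upperBoundOracle_isLarge : upperBoundOracle.IsLarge := fun c hc =>
  ⟨c, hc, fun _ _ _ hn => hn⟩

/-! ### Views -/

/-- Keeps `Outputs`, which quantifies over all listings, from being vacuous. -/
theorem exists_isView {α : Type} {n : ℕ} (G : SimpleGraph (Fin n)) (lab : Fin n → α) (r : ℕ)
    (v : Fin n) : ∃ w, IsView G lab r v w := by
  classical
  let v₀ : {u : Fin n // G.dist v u ≤ r} := ⟨v, by simp⟩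
  have hpos : 0 < Fintype.card {u : Fin n // G.dist v u ≤ r} := Fintype.card_pos_iff.2 ⟨v₀⟩
  obtain ⟨m, hm⟩ := Nat.exists_eq_add_one.2 hpos
  let e := (Fintype.equivFinOfCardEq hm).symm
  exact ⟨_, m, (Equiv.swap 0 (e.symm v₀)).trans e, by simp [v₀], rfl⟩

theorem IsView.congr {α : Type} {n : ℕ} {G : SimpleGraph (Fin n)} {lab lab' : Fin n → α} {r : ℕ}
    {v : Fin n} {w : View α} (h : ∀ u, G.dist v u ≤ r → lab u = lab' u)
    (hw : IsView G lab r v w) : IsView G lab' r v w := by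
  obtain ⟨m, e, he, rfl⟩ := hw
  exact ⟨m, e, he, by simp [h _ (e _).2]⟩

theorem IsView.head?_eq {α : Type} {n : ℕ} {G : SimpleGraph (Fin n)} {lab : Fin n → α} {r : ℕ}
    {v : Fin n} {w : View α} (hw : IsView G lab r v w) : w.head?.map Prod.fst = some (lab v) := by
  obtain ⟨m, e, he, rfl⟩ := hw
  simp [List.ofFn_succ, he]

theorem IsView.exists_mem_iff {α : Type} {n : ℕ} {G : SimpleGraph (Fin n)} {lab : Fin n → α}
    {r : ℕ} {v : Fin n} {w : View α} (hw : IsView G lab r v w) (P : α → Prop) :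
    (∃ a ∈ w, P a.1) ↔ ∃ u, G.dist v u ≤ r ∧ P (lab u) := by
  obtain ⟨m, e, he, rfl⟩ := hw
  constructor
  · rintro ⟨a, ha, hP⟩
    obtain ⟨i, rfl⟩ := (List.mem_ofFn' _ _).1 ha
    exact ⟨e i, (e i).2, hP⟩
  · rintro ⟨u, hu, hP⟩
    exact ⟨_, (List.mem_ofFn' _ _).2 ⟨e.symm ⟨u, hu⟩, rfl⟩, by simpa using hP⟩

/-! ### Node states coded by bit strings -/

/-- A bit string is read, through its length, as a program, a clock value and a claimed output. -/
def stateOf (s : List Bool) : Code × ℕ × ℕ := Denumerable.ofNat _ s.length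

/-- A bit string with a given state. -/
def labelOf (c : Code × ℕ × ℕ) : List Bool := (List.range (Encodable.encode c)).map fun _ => true

@[simp]
theorem stateOf_labelOf (c : Code × ℕ × ℕ) : stateOf (labelOf c) = c := by
  simp only [stateOf, labelOf, List.length_map, List.length_range, Denumerable.ofNat_encode]

theorem primrec_stateOf : Primrec stateOf := (Primrec.ofNat _).comp Primrec.list_length

theorem primrec_labelOf : Primrec labelOf :=
  Primrec.list_map (Primrec.list_range.comp Primrec.encode) (Primrec.const true).to₂

/-! ### The language of claimed outputs -/

/-- A node whose program has not halted within the time shown by its clock has a node with the same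
program and the next clock value in its closed neighbourhood. -/
def Progress {n : ℕ} (G : SimpleGraph (Fin n)) (x : Fin n → List Bool) (v : Fin n) : Prop :=
  evaln (stateOf (x v)).2.1 (stateOf (x v)).1 0 ≠ none ∨
    ∃ u, G.dist v u ≤ 1 ∧ (stateOf (x u)).1 = (stateOf (x v)).1 ∧
      (stateOf (x u)).2.1 = (stateOf (x v)).2.1 + 1

/-- The clocks progress until the programs halt, and at clock value `0` the claimed output is
the output of the program. -/
def claimLanguage : Language :=
  {I | ∀ v, Progress I.graph I.input v ∧ ((stateOf (I.input v)).2.1 = 0 →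
    (stateOf (I.input v)).2.2 ∈ eval (stateOf (I.input v)).1 0)}

/-- Pigeonhole: if `p` did not halt within `n` steps, progress from clock `0` would produce nodes
with all the clock values `0, …, n`, which is `n + 1` distinct nodes. -/
theorem evaln_eq_some_of_progress {n : ℕ} {G : SimpleGraph (Fin n)} {x : Fin n → List Bool}
    (h : ∀ v, Progress G x v) {v : Fin n} (hv : (stateOf (x v)).2.1 = 0) {k : ℕ}
    (hk : k ∈ eval (stateOf (x v)).1 0) {N : ℕ} (hN : n ≤ N) :
    evaln N (stateOf (x v)).1 0 = some k := by
  set p := (stateOf (x v)).1 with hp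
  have key : evaln n p 0 ≠ none := by
    intro hnone
    have hlt : ∀ j ≤ n, evaln j p 0 = none := fun j hj => by
      rw [Option.eq_none_iff_forall_not_mem] at hnone ⊢
      exact fun a ha => hnone a (evaln_mono hj ha)
    have hex : ∀ j ≤ n, ∃ u, (stateOf (x u)).1 = p ∧ (stateOf (x u)).2.1 = j := by
      intro j
      induction j with
      | zero => exact fun _ => ⟨v, rfl, hv⟩
      | succ j ih =>
        intro hj
        obtain ⟨u, hu, huj⟩ := ih (by omega)
        rcases h u with h' | ⟨u', -, h₁, h₂⟩
        · rw [hu, huj] at h'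
          exact absurd (hlt j (by omega)) h'
        · exact ⟨u', h₁.trans hu, by rw [h₂, huj]⟩
    choose u _ hu using fun j : Fin (n + 1) => hex j (by omega)
    have hinj : Function.Injective u := fun a b hab => by
      rw [Fin.ext_iff, ← hu a, ← hu b, hab]
    simpa using Fintype.card_le_of_injective u hinj
  obtain ⟨a, ha⟩ := Option.ne_none_iff_exists'.1 key
  rw [Part.mem_unique hk (evaln_sound ha)]
  exact evaln_mono hN ha

/-! ### The oracle decides the language -/

/-- The root of the view makes progress, and if its clock shows `0`, then its program gives the
claimed output within the number of steps given by the oracle. -/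
def ClaimAccepts (w : View (ℕ × List Bool × ℕ)) : Prop :=
  (evaln (stateOf (w.head?.map Prod.fst).get!.2.1).2.1
      (stateOf (w.head?.map Prod.fst).get!.2.1).1 0 ≠ none ∨
    ∃ a ∈ w, (stateOf a.1.2.1).1 = (stateOf (w.head?.map Prod.fst).get!.2.1).1 ∧
      (stateOf a.1.2.1).2.1 = (stateOf (w.head?.map Prod.fst).get!.2.1).2.1 + 1) ∧
  (¬ (stateOf (w.head?.map Prod.fst).get!.2.1).2.1 = 0 ∨
    evaln (w.head?.map Prod.fst).get!.2.2 (stateOf (w.head?.map Prod.fst).get!.2.1).1 0 =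
      some (stateOf (w.head?.map Prod.fst).get!.2.1).2.2)

theorem primrecPred_claimAccepts : PrimrecPred ClaimAccepts := by
  -- Views are nonempty, but computability concerns all lists; on the empty one `get!` returns the
  -- default.
  have hd : Primrec fun w : View (ℕ × List Bool × ℕ) => (w.head?.map Prod.fst).get! := by
    refine (Primrec.option_getD_default.comp
      (Primrec.option_map Primrec.list_head? (Primrec.fst.comp Primrec.snd).to₂)).of_eq fun w => ?_
    cases w <;> rfl
  have hs : Primrec fun w : View (ℕ × List Bool × ℕ) =>
      stateOf (w.head?.map Prod.fst).get!.2.1 :=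
    primrec_stateOf.comp (Primrec.fst.comp (Primrec.snd.comp hd))
  have hp := Primrec.fst.comp hs
  have hi := Primrec.fst.comp (Primrec.snd.comp hs)
  have ht : Primrec fun q : ((ℕ × List Bool × ℕ) × List Bool) × (Code × ℕ × ℕ) =>
      stateOf q.1.1.2.1 :=
    primrec_stateOf.comp (Primrec.fst.comp (Primrec.snd.comp (Primrec.fst.comp Primrec.fst)))
  have hrel : PrimrecRel fun (a : (ℕ × List Bool × ℕ) × List Bool) (c : Code × ℕ × ℕ) =>
      (stateOf a.1.2.1).1 = c.1 ∧ (stateOf a.1.2.1).2.1 = c.2.1 + 1 :=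
    (Primrec.eq.comp (Primrec.fst.comp ht) (Primrec.fst.comp Primrec.snd)).and
      (Primrec.eq.comp (Primrec.fst.comp (Primrec.snd.comp ht))
        (Primrec.succ.comp (Primrec.fst.comp (Primrec.snd.comp Primrec.snd))))
  refine .and (.or (.not ?_) ?_) (.or (.not ?_) ?_)
  · exact Primrec.eq.comp (primrec_evaln.comp ((hi.pair hp).pair (Primrec.const 0)))
      (Primrec.const none)
  · exact hrel.exists_mem_list.comp Primrec.id hs
  · exact Primrec.eq.comp hi (Primrec.const 0)
  · exact Primrec.eq.comp
      (primrec_evaln.comp (((Primrec.snd.comp (Primrec.snd.comp hd)).pair hp).pair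
        (Primrec.const 0)))
      (Primrec.option_some.comp (Primrec.snd.comp (Primrec.snd.comp hs)))

open Classical in
/-- The decision algorithm for `claimLanguage` with the upper bound oracle. -/
noncomputable def claimAlgorithm : LocalAlgorithm (ℕ × List Bool × ℕ) where
  radius := 1
  out w := decide (ClaimAccepts w)
  computable := primrecPred_claimAccepts.decide.to_comp

/-- The condition under which `claimAlgorithm` accepts at `v`. -/
def NodeAccepts {n : ℕ} (G : SimpleGraph (Fin n)) (x : Fin n → List Bool) (o : Fin n → ℕ)
    (v : Fin n) : Prop :=
  Progress G x v ∧ (¬ (stateOf (x v)).2.1 = 0 ∨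
    evaln (o v) (stateOf (x v)).1 0 = some (stateOf (x v)).2.2)

theorem IsView.claimAccepts_iff {n : ℕ} {G : SimpleGraph (Fin n)} {x : Fin n → List Bool}
    {id o : Fin n → ℕ} {v : Fin n} {w : View (ℕ × List Bool × ℕ)}
    (hw : IsView G (fun v => (id v, x v, o v)) 1 v w) :
    ClaimAccepts w ↔ NodeAccepts G x o v := by
  unfold ClaimAccepts NodeAccepts Progress
  rw [hw.head?_eq, hw.exists_mem_iff fun a => (stateOf a.2.1).1 = _ ∧ (stateOf a.2.1).2.1 = _]
  rfl

open Classical in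
-- `NodeAccepts` involves neither the listing order nor `id`, so the output is well defined and
-- identifier-oblivious.
theorem claimAlgorithm_outputs_iff {n : ℕ} {G : SimpleGraph (Fin n)} {x : Fin n → List Bool}
    {id o : Fin n → ℕ} {v : Fin n} {b : Bool} :
    claimAlgorithm.Outputs G (fun v => (id v, x v, o v)) v b ↔
      decide (NodeAccepts G x o v) = b := by
  constructor
  · intro h
    obtain ⟨w, hw⟩ := exists_isView G (fun v => (id v, x v, o v)) 1 v
    rw [← h w hw]
    exact decide_eq_decide.2 hw.claimAccepts_iff.symm
  · rintro rfl w hw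
    exact decide_eq_decide.2 (IsView.claimAccepts_iff hw)

theorem claimLanguage_mem_LDOWith : claimLanguage ∈ LDOWith upperBoundOracle := by
  classical
  refine ⟨claimAlgorithm, fun I o id id' _ _ v b => ?_, ?_⟩
  · rw [claimAlgorithm_outputs_iff, claimAlgorithm_outputs_iff]
  · rintro I lab ⟨id, -, o, ⟨N, hN, τ, -, rfl⟩, rfl⟩
    refine ⟨fun v => ⟨_, claimAlgorithm_outputs_iff.2 rfl⟩, ?_⟩
    simp only [claimAlgorithm_outputs_iff, decide_eq_true_eq]
    constructor
    · intro h v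
      refine ⟨(h v).1, or_iff_not_imp_left.2 fun h₀ => ?_⟩
      rw [not_not] at h₀
      exact evaln_eq_some_of_progress (fun v => (h v).1) h₀ ((h v).2 h₀) hN
    · exact fun h v => ⟨(h v).1, fun h₀ =>
        evaln_sound ((h v).2.resolve_left (not_not.2 h₀))⟩

/-! ### Distances and views in path graphs -/

theorem pathGraph_dist_le {n : ℕ} : ∀ (k : ℕ) (u v : Fin n), (u : ℕ) + k = v →
    (SimpleGraph.pathGraph n).dist u v ≤ k
  | 0, u, v, h => by
    obtain rfl : u = v := Fin.ext h
    simp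
  | k + 1, u, v, h => by
    let u' : Fin n := ⟨u + 1, by omega⟩
    have hadj : (SimpleGraph.pathGraph n).Adj u u' := SimpleGraph.pathGraph_adj.2 (Or.inl rfl)
    have hle := pathGraph_dist_le k u' v (by simp only [u']; omega)
    obtain ⟨w, hw⟩ := (SimpleGraph.pathGraph_preconnected n u' v).exists_walk_length_eq_dist
    have := SimpleGraph.dist_le (SimpleGraph.Walk.cons hadj w)
    simp only [SimpleGraph.Walk.length_cons] at this
    omega

theorem pathGraph_walk_length {n : ℕ} {u v : Fin n} (w : (SimpleGraph.pathGraph n).Walk u v) :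
    (u : ℕ) ≤ v + w.length ∧ (v : ℕ) ≤ u + w.length := by
  induction w with
  | nil => simp
  | cons h w ih =>
    rw [SimpleGraph.pathGraph_adj] at h
    simp only [SimpleGraph.Walk.length_cons]
    omega

theorem pathGraph_dist_le_iff {n : ℕ} {u v : Fin n} {k : ℕ} :
    (SimpleGraph.pathGraph n).dist u v ≤ k ↔ (u : ℕ) ≤ v + k ∧ (v : ℕ) ≤ u + k := by
  constructor
  · intro h
    obtain ⟨w, hw⟩ := (SimpleGraph.pathGraph_preconnected n u v).exists_walk_length_eq_dist
    have := pathGraph_walk_length w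
    omega
  · rintro ⟨h₁, h₂⟩
    rcases le_total (u : ℕ) v with h | h
    · exact (pathGraph_dist_le (v - u) u v (by omega)).trans (by omega)
    · rw [SimpleGraph.dist_comm]
      exact (pathGraph_dist_le (u - v) v u (by omega)).trans (by omega)

/-- A list of the nodes at distance at most `r` from the node `j ≤ r` of a path. -/
def pathBall (j r : ℕ) (i : Fin (j + r + 1)) : ℕ :=
  Equiv.swap 0 (⟨j, by omega⟩ : Fin (j + r + 1)) i

/-- The view of the node `j ≤ r` of a long path, with the positions as node data. -/
def pathView (j r : ℕ) : View ℕ :=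
  List.ofFn fun i => (pathBall j r i, List.ofFn fun k =>
    decide (pathBall j r i + 1 = pathBall j r k ∨ pathBall j r k + 1 = pathBall j r i))

/-- The ball is `{0, …, j + r}` for every such `n`, so a program can write down the view without
knowing the length of the path. -/
theorem isView_pathView {α : Type} {n j r : ℕ} (hj : j ≤ r) (hn : j + r < n) (lab : ℕ → α) :
    IsView (SimpleGraph.pathGraph n) (fun v => lab v) r ⟨j, by omega⟩
      ((pathView j r).map fun a => (lab a.1, a.2)) := by
  let e₀ : Fin (j + r + 1) ≃
      {u : Fin n // (SimpleGraph.pathGraph n).dist ⟨j, by omega⟩ u ≤ r} :=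
    { toFun := fun i => ⟨⟨i, by omega⟩, pathGraph_dist_le_iff.2 ⟨by simp; omega, by simp; omega⟩⟩
      invFun := fun u => ⟨u.1, by have := (pathGraph_dist_le_iff.1 u.2).2; simp at this; omega⟩
      left_inv := fun _ => rfl
      right_inv := fun _ => rfl }
  refine ⟨j + r, (Equiv.swap 0 ⟨j, by omega⟩).trans e₀, by simp [e₀], ?_⟩
  simp only [pathView, List.map_ofFn, SimpleGraph.pathGraph_adj]
  congr 1

/-! ### No algorithm with identifiers decides the language -/

/-- The label at position `k` of a path: the claimed output is written at position `0` only. -/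
def claimLabel (p : Code) (b k : ℕ) : List Bool := labelOf (p, k, if k = 0 then b else 0)

/-- The path with `n + 1` nodes on which clocks count from `0`. -/
def claimPath (p : Code) (b n : ℕ) : LabelledGraph where
  n := n + 1
  graph := SimpleGraph.pathGraph (n + 1)
  connected := SimpleGraph.pathGraph_connected n
  input v := claimLabel p b v

theorem claimPath_mem_iff {p : Code} {b k T n : ℕ} (hk : k ∈ evaln T p 0) (hT : T ≤ n) :
    claimPath p b n ∈ claimLanguage ↔ b = k := by
  constructor
  · intro h
    have := (h (0 : Fin (n + 1))).2
    simp only [claimPath, claimLabel, stateOf_labelOf, Fin.val_zero, if_true] at this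
    exact Part.mem_unique (this trivial) (evaln_sound hk)
  · rintro rfl v
    simp only [claimPath, claimLabel, stateOf_labelOf, Progress]
    refine ⟨?_, fun h => by simpa [h] using evaln_sound hk⟩
    change Fin (n + 1) at v
    -- From position `T` on the program has halted; before `T ≤ n` there is a next node.
    rcases le_or_gt T v with hv | hv
    · exact Or.inl fun h => by simpa [h] using evaln_mono hv hk
    · exact Or.inr ⟨⟨v + 1, by omega⟩, pathGraph_dist_le 1 _ _ rfl, by simp⟩

/-- The data at position `k` of a path whose nodes are identified by their positions. -/
def claimData (p : Code) (b k : ℕ) : ℕ × List Bool := (k, claimLabel p b k)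

theorem claimData_mem_idData (p : Code) (b n : ℕ) :
    (fun v : Fin (n + 1) => claimData p b v) ∈ idData (claimPath p b n) :=
  ⟨fun v => Fin.val v, Fin.val_injective, rfl⟩

theorem primrec_claimData : Primrec fun q : (Code × ℕ) × ℕ => claimData q.1.1 q.1.2 q.2 :=
  Primrec.snd.pair <| primrec_labelOf.comp <| (Primrec.fst.comp Primrec.fst).pair <|
    Primrec.snd.pair <| Primrec.ite (Primrec.eq.comp Primrec.snd (Primrec.const 0))
      (Primrec.snd.comp Primrec.fst) (Primrec.const 0)

/-- The view of the node `j ≤ r` in a long `claimPath`. -/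
def claimView (r : ℕ) (p : Code) (b j : ℕ) : View (ℕ × List Bool) :=
  (pathView j r).map fun a => (claimData p b a.1, a.2)

theorem primrec_claimView (r b j : ℕ) : Primrec fun p => claimView r p b j :=
  Primrec.list_map (Primrec.const _)
    ((primrec_claimData.comp ((Primrec.fst.pair (Primrec.const b)).pair
      (Primrec.fst.comp Primrec.snd))).pair (Primrec.snd.comp Primrec.snd)).to₂

/-- `A` accepts at the first `m` nodes of a long path with claimed output `b`. -/
def acceptsNear (A : LocalAlgorithm (ℕ × List Bool)) (p : Code) (b : ℕ) : ℕ → Bool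
  | 0 => true
  | m + 1 => bif acceptsNear A p b m then A.out (claimView A.radius p b m) else false

theorem acceptsNear_iff {A : LocalAlgorithm (ℕ × List Bool)} {p : Code} {b m : ℕ} :
    acceptsNear A p b m = true ↔ ∀ j < m, A.out (claimView A.radius p b j) = true := by
  induction m with
  | zero => simp [acceptsNear]
  | succ m ih => rw [Nat.forall_lt_succ_right, ← ih]; simp [acceptsNear]

theorem computable_acceptsNear (A : LocalAlgorithm (ℕ × List Bool)) (b : ℕ) :
    ∀ m, Computable fun p => acceptsNear A p b m
  | 0 => Computable.const true
  | m + 1 => Computable.cond (computable_acceptsNear A b m)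
      (A.computable.comp (primrec_claimView _ b m).to_comp) (Computable.const false)

theorem claimLanguage_notMem_LD : claimLanguage ∉ LD := by
  rintro ⟨A, hA⟩
  let D : Code → Bool := fun p => acceptsNear A p 1 (A.radius + 1)
  have hpart : Partrec₂ fun (p : Code) (_ : ℕ) => (Part.some (bif D p then 0 else 1) : Part ℕ) :=
    (Computable.cond ((computable_acceptsNear A 1 _).comp Computable.fst) (Computable.const 0)
      (Computable.const 1)).partrec
  -- The self-referential program: its output contradicts the verdict of `A` near the claim `1`.
  obtain ⟨p, hp⟩ := fixed_point₂ hpart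
  have hout : (bif D p then 0 else 1) ∈ eval p 0 := by rw [hp]; exact Part.mem_some _
  obtain ⟨T, hT⟩ := evaln_complete.1 hout
  -- Long enough for the clocks to reach `T` and for the first `A.radius + 1` views not to meet the
  -- right end.
  let n := T + 2 * A.radius
  have hview : ∀ b j (hj : j ≤ A.radius), IsView (claimPath p b n).graph
      (fun v : Fin (n + 1) => claimData p b v) A.radius (⟨j, by omega⟩ : Fin (n + 1))
      (claimView A.radius p b j) :=
    fun b j hj => isView_pathView (n := n + 1) hj (by omega) _
  cases hD : D p with
  | false =>
    rw [hD] at hT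
    have hmem : claimPath p 1 n ∈ claimLanguage := (claimPath_mem_iff hT (by omega)).2 rfl
    have hall := (hA _ _ (claimData_mem_idData p 1 n)).2.1 hmem
    refine absurd (acceptsNear_iff.2 fun j hj => ?_) (Bool.eq_false_iff.1 hD)
    exact hall _ _ (hview 1 j (by omega))
  | true =>
    rw [hD] at hT
    have hmem : claimPath p 0 n ∈ claimLanguage := (claimPath_mem_iff hT (by omega)).2 rfl
    have hnot : claimPath p 1 n ∉ claimLanguage := fun h =>
      one_ne_zero ((claimPath_mem_iff hT (by omega)).1 h)
    have hyes := (hA _ _ (claimData_mem_idData p 0 n)).2.1 hmem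
    obtain ⟨hdet, hiff⟩ := hA _ _ (claimData_mem_idData p 1 n)
    refine hnot (hiff.2 fun (v : Fin (n + 1)) => ?_)
    rcases le_or_gt (v : ℕ) A.radius with hv | hv
    -- `D` tests one listing of the view; `hdet` carries its value over to all listings.
    · obtain ⟨b, hb⟩ := hdet v
      have h₁ : A.out (claimView A.radius p 1 v) = true := acceptsNear_iff.1 hD v (by omega)
      rw [hb _ (hview 1 v hv)] at h₁
      exact h₁ ▸ hb
    -- The two paths differ only at position `0`, which is out of sight here.
    · refine fun w hw => hyes v w (IsView.congr (fun (u : Fin (n + 1)) hu => ?_) hw)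
      have := (pathGraph_dist_le_iff.1 hu).1
      have hu₀ : (u : ℕ) ≠ 0 := by omega
      simp [claimData, claimLabel, hu₀]

end LocalDecision

theorem theorem4 :
    LocalDecision.upperBoundOracle.IsLarge ∧
    ∃ L : LocalDecision.Language,
      L ∈ LocalDecision.LDOWith LocalDecision.upperBoundOracle ∧ L ∉ LocalDecision.LD :=
  ⟨LocalDecision.upperBoundOracle_isLarge, LocalDecision.claimLanguage,
    LocalDecision.claimLanguage_mem_LDOWith, LocalDecision.claimLanguage_notMem_LD⟩
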